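/- Let $0<R_1$ and $R_2>3R_1$. Let $X$ and $Y$ be independent random points of the Euclidean plane, where $Y$ is uniformly distributed on the annulus $\{R_1\le|y|\le R_2\}$, and where one of the following holds. Scenario $s_1$: $X$ is uniformly distributed on the disk $\{|x|\le R_1\}$. Scenario $s_2$: $X$ follows the random waypoint distribution on this disk, in the sense that $|X|$ has the probability density $\frac{4\rho}{R_1^2}\bigl(1-\frac{\rho^2}{R_1^2}\bigr)$ for $0\le\rho\le R_1$ (and $0$ elsewhere). Then in both scenarios the distance $|X-Y|$ has the probability density function $$f(r)=\begin{cases}\dfrac{2r}{S R_1}\bigl(\pi R_1+p_1(r)\sin\phi_0(r)+p_2(r)\phi_0(r)\bigr), & 0\le r\le 2R_1,\\[6pt] \dfrac{2r}{R_2^2-R_1^2}, & 2R_1<r\le R_2-R_1,\\[6pt] \dfrac{2r}{S R_1^2}\bigl(p_3(r)\sin\phi_1(r)+p_4(r)\phi_1(r)+p_5(r)\phi_2(r)+p_6(r)k(r)\bigr), & R_2-R_1<r\le R_1+R_2,\end{cases}$$ and $f(r)=0$ for all other $r$; moreover $f\ge 0$ everywhere. Here $S=\pi(R_2^2-R_1^2)$,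 $\phi_0(r)=\arccos\frac{r^2}{2rR_1}$, $\phi_1(r)=\arccos\frac{R_2^2+r^2-R_1^2}{2rR_2}$, $\phi_2(r)=\arccos\frac{R_1^2+r^2-R_2^2}{2rR_1}$ (at $r=0$ the factor $2r$ makes $f(0)=0$), $k(r)=\sqrt{(r^2-(R_2-R_1)^2)((R_1+R_2)^2-r^2)}$, and the coefficients are, in scenario $s_1$, $$p_1=r,\quad p_2=-2R_1,\quad p_3=-rR_2,\quad p_4=R_2^2,\quad p_5=R_1^2,\quad p_6=0,$$ and in scenario $s_2$, $$p_1=-\frac{r(2R_1^2+r^2)}{2R_1^2},\quad p_2=-\frac{2(R_1^2-r^2)}{R_1},\quad p_3=0,\quad p_4=\frac{R_2^2(2R_1^2-2r^2-R_2^2)}{R_1^2},\quad p_5=R_1^2,\quad p_6=\frac{r^2-3R_1^2+5R_2^2}{4R_1^2}.$$ -/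

import Mathlib

open MeasureTheory ProbabilityTheory

noncomputable section

namespace DiskAnnulus

/-- The Euclidean plane. -/
abbrev Plane := EuclideanSpace ℝ (Fin 2)

/-- The closed disk of radius `R₁` around the origin. -/
def disk (R₁ : ℝ) : Set Plane := {x | ‖x‖ ≤ R₁}

/-- The annulus with radii `R₁` and `R₂` around the origin. -/
def annulus (R₁ R₂ : ℝ) : Set Plane := {x | R₁ ≤ ‖x‖ ∧ ‖x‖ ≤ R₂}

/-- `f` is a probability density function (with respect to Lebesgue measure) of the real random
variable `Z` under `P`: `f` is nonnegative, `Z` has a density, and the density is `f` almost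
everywhere. -/
def IsDensityOf {Ω : Type*} [MeasurableSpace Ω] (f : ℝ → ℝ) (Z : Ω → ℝ) (P : Measure Ω) : Prop :=
  (∀ r, 0 ≤ f r) ∧ HasPDF Z P volume ∧ pdf Z P volume =ᵐ[volume] fun r => ENNReal.ofReal (f r)

/-- The two scenarios: in `s₁` node 1 is static, in `s₂` it is mobile. -/
inductive Scenario
  | s₁
  | s₂

/-- Density of the distance from the center of a node that follows the stationary distribution of
the random waypoint model in the disk of radius `R₁`. -/
def rwpRadialDensity (R₁ ρ : ℝ) : ℝ :=
  if 0 ≤ ρ ∧ ρ ≤ R₁ then 4 * ρ / R₁ ^ 2 * (1 - ρ ^ 2 / R₁ ^ 2) else 0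

/-- The law of node 1. In `s₁` it is uniform on the disk; in `s₂` its distance from the center has
the random waypoint density (nothing is required of its direction). -/
def Node1Law {Ω : Type*} [MeasurableSpace Ω] (s : Scenario) (R₁ : ℝ) (X : Ω → Plane)
    (P : Measure Ω) : Prop :=
  match s with
  | .s₁ => pdf.IsUniform X (disk R₁) P volume
  | .s₂ => IsDensityOf (rwpRadialDensity R₁) (fun ω => ‖X ω‖) P

/-- Area of the annulus. -/
def S (R₁ R₂ : ℝ) : ℝ := Real.pi * (R₂ ^ 2 - R₁ ^ 2)

/-- Angular limit given by the circle of radius `R₁`. -/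
def θ₁ (R₁ ρ r : ℝ) : ℝ := Real.arccos ((ρ ^ 2 + r ^ 2 - R₁ ^ 2) / (2 * r * ρ))

/-- Angular limit given by the circle of radius `R₂`. -/
def θ₂ (R₂ ρ r : ℝ) : ℝ := Real.arccos ((ρ ^ 2 + r ^ 2 - R₂ ^ 2) / (2 * r * ρ))

def φ₀ (R₁ r : ℝ) : ℝ := θ₁ R₁ R₁ r

def φ₁ (R₁ R₂ r : ℝ) : ℝ := θ₁ R₁ R₂ r

def φ₂ (R₁ R₂ r : ℝ) : ℝ := θ₂ R₂ R₁ r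

def k (R₁ R₂ r : ℝ) : ℝ := Real.sqrt ((r ^ 2 - (R₂ - R₁) ^ 2) * ((R₁ + R₂) ^ 2 - r ^ 2))

def p₁ (s : Scenario) (R₁ r : ℝ) : ℝ :=
  match s with
  | .s₁ => r
  | .s₂ => -(r * (2 * R₁ ^ 2 + r ^ 2) / (2 * R₁ ^ 2))

def p₂ (s : Scenario) (R₁ r : ℝ) : ℝ :=
  match s with
  | .s₁ => -2 * R₁
  | .s₂ => -(2 * (R₁ ^ 2 - r ^ 2) / R₁)

def p₃ (s : Scenario) (R₂ r : ℝ) : ℝ :=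
  match s with
  | .s₁ => -r * R₂
  | .s₂ => 0

def p₄ (s : Scenario) (R₁ R₂ r : ℝ) : ℝ :=
  match s with
  | .s₁ => R₂ ^ 2
  | .s₂ => R₂ ^ 2 * (2 * R₁ ^ 2 - 2 * r ^ 2 - R₂ ^ 2) / R₁ ^ 2

def p₅ (R₁ : ℝ) : ℝ := R₁ ^ 2

def p₆ (s : Scenario) (R₁ R₂ r : ℝ) : ℝ :=
  match s with
  | .s₁ => 0
  | .s₂ => (r ^ 2 - 3 * R₁ ^ 2 + 5 * R₂ ^ 2) / (4 * R₁ ^ 2)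

/-- The piecewise closed form for `R₂ > 3 R₁`, extended by `0` outside `[0, R₁ + R₂]`. -/
def distanceDensity (s : Scenario) (R₁ R₂ r : ℝ) : ℝ :=
  if 0 ≤ r ∧ r ≤ 2 * R₁ then
    2 * r / (S R₁ R₂ * R₁) *
      (Real.pi * R₁ + p₁ s R₁ r * Real.sin (φ₀ R₁ r) + p₂ s R₁ r * φ₀ R₁ r)
  else if 2 * R₁ < r ∧ r ≤ R₂ - R₁ then
    2 * r / (R₂ ^ 2 - R₁ ^ 2)
  else if R₂ - R₁ < r ∧ r ≤ R₁ + R₂ then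
    2 * r / (S R₁ R₂ * R₁ ^ 2) *
      (p₃ s R₂ r * Real.sin (φ₁ R₁ R₂ r) + p₄ s R₁ R₂ r * φ₁ R₁ R₂ r +
        p₅ R₁ * φ₂ R₁ R₂ r + p₆ s R₁ R₂ r * k R₁ R₂ r)
  else 0

end DiskAnnulus

end

/-!
Condition on `X`. A point at distance `ρ` from the center sees the points at distance `r` inside the
open disk of radius `R` under an angle `2 * θ₁ R ρ r` (law of cosines; the clamping of `arccos` to
`[0, π]` takes care of circles that are nested or too far apart). Polar coordinates around `X`
therefore show that `|X - Y|` has, given `‖X‖ = ρ`, the density `2 r / S * (θ₁ R₂ ρ r - θ₁ R₁ ρ r)`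
(`cond_annulus_preimage_dist`). It depends on `X` through `‖X‖` only, which is why nothing about the
direction of `X` is needed. By Tonelli the density of `|X - Y|` is the mean of this expression over
the density of `‖X‖`, which is `2 ρ / R₁ ^ 2` or the random waypoint density
(`map_norm_eq_withDensity`, `map_dist_eq_withDensity`).

Both radial densities are combinations of `ρ` and `ρ ^ 3`, so the mean reduces to the integrals over
`[0, R₁]` of `ρ * θ₁ R ρ r` and `ρ ^ 3 * θ₁ R ρ r` for `R = R₁, R₂`. These have elementary
primitives built from `θ₁ R ρ r`, `θ₁ ρ R r` and `k ρ R r`, which are respectively two angles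
and four times the area of the triangle with sides `ρ`, `R`, `r`. Because `arccos` and the square
root are clamped, a single formula is a continuous primitive on all of `[0, R]`; it only fails to be
differentiable at `ρ = |R - r|`, where the circles become tangent. For
`r ≤ R₂ - R₁` the mean angle of the outer circle is `π`, for `2 R₁ ≤ r` that of the inner circle is
`0`, and evaluating the primitives for the remaining circle gives the three branches of
`distanceDensity` (`distanceDensity_eq`). Nonnegativity follows since `θ₁` is monotone in the
radius.
-/

open MeasureTheory ProbabilityTheory

namespace DiskAnnulus

/-! ### The angle of a triangle and its derivatives -/

/-- Heron's formula: by the law of cosines, `(b ^ 2 + c ^ 2 - a ^ 2) / (2 * c * b)` is the cosine of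
the angle opposite to the side `a`. -/
theorem one_sub_sq_cosine {a b c : ℝ} (hb : b ≠ 0) (hc : c ≠ 0) :
    1 - ((b ^ 2 + c ^ 2 - a ^ 2) / (2 * c * b)) ^ 2 =
      ((c ^ 2 - (a - b) ^ 2) * ((b + a) ^ 2 - c ^ 2)) / (2 * c * b) ^ 2 := by
  field_simp
  ring

theorem k_eq_mul_sin {a b c : ℝ} (hb : 0 < b) (hc : 0 < c) :
    k b a c = 2 * c * b * Real.sin (θ₁ a b c) := by
  rw [θ₁, Real.sin_arccos, one_sub_sq_cosine hb.ne' hc.ne', Real.sqrt_div' _ (by positivity),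
    Real.sqrt_sq (by positivity), k]
  field_simp

theorem hasDerivAt_θ₁_fst {R ρ r : ℝ} (hR : 0 < R) (hρ : 0 < ρ) (hr : 0 < r)
    (h : 0 < (r ^ 2 - (R - ρ) ^ 2) * ((ρ + R) ^ 2 - r ^ 2)) :
    HasDerivAt (fun x => θ₁ x R r) (2 * ρ / k ρ R r) ρ := by
  have h1 : 0 < 1 - ((R ^ 2 + r ^ 2 - ρ ^ 2) / (2 * r * R)) ^ 2 := by
    rw [one_sub_sq_cosine hR.ne' hr.ne']
    have : (r ^ 2 - (ρ - R) ^ 2) * ((R + ρ) ^ 2 - r ^ 2) =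
      (r ^ 2 - (R - ρ) ^ 2) * ((ρ + R) ^ 2 - r ^ 2) := by ring
    rw [this]
    positivity
  have hk : √(1 - ((R ^ 2 + r ^ 2 - ρ ^ 2) / (2 * r * R)) ^ 2) = k ρ R r / (2 * r * R) := by
    rw [one_sub_sq_cosine hR.ne' hr.ne', Real.sqrt_div' _ (by positivity),
      Real.sqrt_sq (by positivity), k]
    ring_nf
  have hkpos : 0 < k ρ R r := Real.sqrt_pos.2 h
  have hd : HasDerivAt (fun x : ℝ => (R ^ 2 + r ^ 2 - x ^ 2) / (2 * r * R))
      (-(2 * ρ) / (2 * r * R)) ρ := by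
    have := (((hasDerivAt_id ρ).pow 2).const_sub (R ^ 2 + r ^ 2)).div_const (2 * r * R)
    simpa using this
  have := (Real.hasDerivAt_arccos (x := (R ^ 2 + r ^ 2 - ρ ^ 2) / (2 * r * R))
    (by rintro h; rw [h] at h1; norm_num at h1) (by rintro h; rw [h] at h1; norm_num at h1)).comp
      ρ hd
  refine this.congr_deriv ?_
  rw [hk]
  field_simp

theorem hasDerivAt_θ₁_snd {R ρ r : ℝ} (hρ : 0 < ρ) (hr : 0 < r)
    (h : 0 < (r ^ 2 - (R - ρ) ^ 2) * ((ρ + R) ^ 2 - r ^ 2)) :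
    HasDerivAt (fun x => θ₁ R x r) (-((ρ ^ 2 - r ^ 2 + R ^ 2) / (ρ * k ρ R r))) ρ := by
  have h1 : 0 < 1 - ((ρ ^ 2 + r ^ 2 - R ^ 2) / (2 * r * ρ)) ^ 2 := by
    rw [one_sub_sq_cosine hρ.ne' hr.ne']
    positivity
  have hk : √(1 - ((ρ ^ 2 + r ^ 2 - R ^ 2) / (2 * r * ρ)) ^ 2) = k ρ R r / (2 * r * ρ) := by
    rw [one_sub_sq_cosine hρ.ne' hr.ne', Real.sqrt_div' _ (by positivity),
      Real.sqrt_sq (by positivity), k]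
  have hkpos : 0 < k ρ R r := Real.sqrt_pos.2 h
  have hd : HasDerivAt (fun x : ℝ => (x ^ 2 + r ^ 2 - R ^ 2) / (2 * r * x))
      ((ρ ^ 2 - r ^ 2 + R ^ 2) / (2 * r * ρ ^ 2)) ρ := by
    have h2 : HasDerivAt (fun x : ℝ => x ^ 2 + r ^ 2 - R ^ 2) (2 * ρ) ρ := by
      simpa using (((hasDerivAt_id ρ).pow 2).add_const (r ^ 2)).sub_const (R ^ 2)
    have h3 : HasDerivAt (fun x : ℝ => 2 * r * x) (2 * r) ρ := by
      simpa using (hasDerivAt_id ρ).const_mul (2 * r)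
    refine (h2.div h3 (by positivity)).congr_deriv ?_
    field_simp
    ring
  have := (Real.hasDerivAt_arccos (x := (ρ ^ 2 + r ^ 2 - R ^ 2) / (2 * r * ρ))
    (by rintro h; rw [h] at h1; norm_num at h1) (by rintro h; rw [h] at h1; norm_num at h1)).comp
      ρ hd
  refine this.congr_deriv ?_
  rw [hk]
  field_simp

theorem hasDerivAt_k_fst {R ρ r : ℝ}
    (h : 0 < (r ^ 2 - (R - ρ) ^ 2) * ((ρ + R) ^ 2 - r ^ 2)) :
    HasDerivAt (fun x => k x R r) (-(2 * ρ * (ρ ^ 2 - R ^ 2 - r ^ 2) / k ρ R r)) ρ := by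
  have hd : HasDerivAt (fun x : ℝ => (r ^ 2 - (R - x) ^ 2) * ((x + R) ^ 2 - r ^ 2))
      (-(4 * ρ * (ρ ^ 2 - R ^ 2 - r ^ 2))) ρ := by
    have h1 := (((hasDerivAt_id ρ).const_sub R).pow 2).const_sub (r ^ 2)
    have h2 := (((hasDerivAt_id ρ).add_const R).pow 2).sub_const (r ^ 2)
    refine (h1.mul h2).congr_deriv ?_
    simp
    ring
  refine (hd.sqrt h.ne').congr_deriv ?_
  have hkpos : 0 < k ρ R r := Real.sqrt_pos.2 h
  change _ / (2 * k ρ R r) = _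
  field_simp
  ring

theorem θ₁_eq_zero {R ρ r : ℝ} (hρ : 0 < ρ) (hr : 0 < r) (h : R ^ 2 ≤ (r - ρ) ^ 2) :
    θ₁ R ρ r = 0 := by
  apply Real.arccos_of_one_le
  rw [le_div_iff₀ (by positivity)]
  linarith

theorem θ₁_eq_pi {R ρ r : ℝ} (hρ : 0 < ρ) (hr : 0 < r) (h : (r + ρ) ^ 2 ≤ R ^ 2) :
    θ₁ R ρ r = Real.pi := by
  apply Real.arccos_of_le_neg_one
  rw [div_le_iff₀ (by positivity)]
  linarith

theorem k_eq_zero_of_le_sub {R ρ r : ℝ} (h : r ^ 2 ≤ (R - ρ) ^ 2) (h' : r ^ 2 ≤ (ρ + R) ^ 2) :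
    k ρ R r = 0 :=
  Real.sqrt_eq_zero_of_nonpos (mul_nonpos_of_nonpos_of_nonneg (by linarith) (by linarith))

theorem k_eq_zero_of_add_le {R ρ r : ℝ} (h : (R - ρ) ^ 2 ≤ r ^ 2) (h' : (ρ + R) ^ 2 ≤ r ^ 2) :
    k ρ R r = 0 :=
  Real.sqrt_eq_zero_of_nonpos (mul_nonpos_of_nonneg_of_nonpos (by linarith) (by linarith))

/-- The three functions entering the primitives are differentiable in `ρ` away from `|R - r|`; their
derivatives satisfy the two linear relations that make the primitives correct. -/
theorem exists_hasDerivAt {R r ρ : ℝ} (hr : 0 < r) (hρ : 0 < ρ) (hρR : ρ < R)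
    (hne : ρ ≠ |R - r|) :
    ∃ t u v : ℝ, HasDerivAt (fun x => θ₁ R x r) t ρ ∧ HasDerivAt (fun x => θ₁ x R r) u ρ ∧
      HasDerivAt (fun x => k x R r) v ρ ∧ ρ ^ 2 / 2 * t + R ^ 2 / 2 * u - v / 4 = 0 ∧
      ρ ^ 4 / 4 * t + R ^ 2 * (R ^ 2 + 2 * r ^ 2) / 4 * u -
        (2 * ρ * k ρ R r + (ρ ^ 2 + 5 * R ^ 2 + r ^ 2) * v) / 16 = 0 := by
  have hR : 0 < R := hρ.trans hρR
  rcases lt_or_gt_of_ne hne with hlt | hgt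
  -- For `ρ < |R - r|` the triangle inequality fails and the three functions are locally constant.
  · have hmem : Set.Ioo 0 |R - r| ∈ nhds ρ := Ioo_mem_nhds hρ hlt
    have key : ∃ a : ℝ, ∀ x ∈ Set.Ioo 0 |R - r|, θ₁ R x r = a ∧ θ₁ x R r = 0 ∧ k x R r = 0 := by
      rcases le_total r R with hrR | hRr
      · refine ⟨Real.pi, fun x ⟨hx0, hx⟩ => ?_⟩
        rw [abs_of_nonneg (by linarith)] at hx
        exact ⟨θ₁_eq_pi hx0 hr (by gcongr; linarith), θ₁_eq_zero hR hr (by nlinarith),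
          k_eq_zero_of_le_sub (by gcongr; linarith) (by gcongr; linarith)⟩
      · refine ⟨0, fun x ⟨hx0, hx⟩ => ?_⟩
        rw [abs_of_nonpos (by linarith)] at hx
        exact ⟨θ₁_eq_zero hx0 hr (by gcongr; linarith), θ₁_eq_zero hR hr (by nlinarith),
          k_eq_zero_of_add_le (by nlinarith) (by gcongr; linarith)⟩
    obtain ⟨a, ha⟩ := key
    have ev := fun {f : ℝ → ℝ} {b : ℝ} (hf : ∀ x ∈ Set.Ioo 0 |R - r|, f x = b) =>
      (hasDerivAt_const ρ b).congr_of_eventuallyEq (Filter.eventually_of_mem hmem hf)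
    refine ⟨0, 0, 0, ev fun x hx => (ha x hx).1, ev fun x hx => (ha x hx).2.1,
      ev fun x hx => (ha x hx).2.2, by ring, ?_⟩
    rw [(ha ρ ⟨hρ, hlt⟩).2.2]
    ring
  · rw [abs_lt] at hgt
    have h : 0 < (r ^ 2 - (R - ρ) ^ 2) * ((ρ + R) ^ 2 - r ^ 2) :=
      mul_pos (by nlinarith) (by nlinarith)
    refine ⟨_, _, _, hasDerivAt_θ₁_snd hρ hr h, hasDerivAt_θ₁_fst hR hρ hr h,
      hasDerivAt_k_fst h, ?_, ?_⟩
    · have hkpos : 0 < k ρ R r := Real.sqrt_pos.2 h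
      field_simp
      ring
    · have hkpos : 0 < k ρ R r := Real.sqrt_pos.2 h
      have hk2 : k ρ R r ^ 2 = (r ^ 2 - (R - ρ) ^ 2) * ((ρ + R) ^ 2 - r ^ 2) :=
        Real.sq_sqrt h.le
      field_simp
      rw [hk2]
      ring

/-! ### Primitives of the weighted angle -/

/-- Antiderivative, in `ρ`, of `ρ ↦ ρ * θ₁ R ρ r`; it is half the area of the intersection of two
disks of radii `ρ` and `R` whose centers are `r` apart. -/
noncomputable def lensPrimitive (R r ρ : ℝ) : ℝ :=
  ρ ^ 2 / 2 * θ₁ R ρ r + R ^ 2 / 2 * θ₁ ρ R r - k ρ R r / 4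

/-- Antiderivative, in `ρ`, of `ρ ↦ ρ ^ 3 * θ₁ R ρ r`. -/
noncomputable def cubicPrimitive (R r ρ : ℝ) : ℝ :=
  ρ ^ 4 / 4 * θ₁ R ρ r + R ^ 2 * (R ^ 2 + 2 * r ^ 2) / 4 * θ₁ ρ R r -
    (ρ ^ 2 + 5 * R ^ 2 + r ^ 2) * k ρ R r / 16

theorem hasDerivAt_lensPrimitive {R r ρ : ℝ} (hr : 0 < r) (hρ : 0 < ρ) (hρR : ρ < R)
    (hne : ρ ≠ |R - r|) : HasDerivAt (lensPrimitive R r) (ρ * θ₁ R ρ r) ρ := by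
  obtain ⟨t, u, v, ht, hu, hv, h1, -⟩ := exists_hasDerivAt hr hρ hρR hne
  have hp : HasDerivAt (fun x : ℝ => x ^ 2 / 2) ρ ρ := by
    simpa using ((hasDerivAt_id ρ).pow 2).div_const 2
  refine (((hp.mul ht).add (hu.const_mul (R ^ 2 / 2))).sub (hv.div_const 4)).congr_deriv ?_
  linear_combination h1

theorem hasDerivAt_cubicPrimitive {R r ρ : ℝ} (hr : 0 < r) (hρ : 0 < ρ) (hρR : ρ < R)
    (hne : ρ ≠ |R - r|) : HasDerivAt (cubicPrimitive R r) (ρ ^ 3 * θ₁ R ρ r) ρ := by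
  obtain ⟨t, u, v, ht, hu, hv, -, h1⟩ := exists_hasDerivAt hr hρ hρR hne
  have hp : HasDerivAt (fun x : ℝ => x ^ 4 / 4) (ρ ^ 3) ρ := by
    refine (((hasDerivAt_id ρ).pow 4).div_const 4).congr_deriv ?_
    simp
  have hq : HasDerivAt (fun x : ℝ => x ^ 2 + 5 * R ^ 2 + r ^ 2) (2 * ρ) ρ := by
    simpa using (((hasDerivAt_id ρ).pow 2).add_const (5 * R ^ 2)).add_const (r ^ 2)
  refine (((hp.mul ht).add (hu.const_mul (R ^ 2 * (R ^ 2 + 2 * r ^ 2) / 4))).sub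
    ((hq.mul hv).div_const 16)).congr_deriv ?_
  linear_combination h1

/-- The angle itself may jump to the junk value `arccos 0` at `ρ = 0`; the factor `ρ ^ n` removes
this discontinuity. -/
theorem continuous_pow_mul_θ₁ (R r : ℝ) {n : ℕ} (hn : n ≠ 0) (hr : r ≠ 0) :
    Continuous fun ρ => ρ ^ n * θ₁ R ρ r := by
  rw [continuous_iff_continuousAt]
  intro ρ
  by_cases hρ : ρ = 0
  · subst hρ
    have h0 : (0 : ℝ) ^ n * θ₁ R 0 r = 0 := by simp [hn]
    rw [ContinuousAt, h0]
    have hb : Filter.Tendsto (fun x : ℝ => |x| ^ n * Real.pi) (nhds 0) (nhds 0) := by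
      have : Continuous fun x : ℝ => |x| ^ n * Real.pi := by fun_prop
      simpa [hn] using this.tendsto 0
    refine squeeze_zero_norm (fun x => ?_) hb
    rw [norm_mul, norm_pow, Real.norm_eq_abs, Real.norm_eq_abs, θ₁,
      abs_of_nonneg (Real.arccos_nonneg _)]
    gcongr
    exact Real.arccos_le_pi _
  · unfold θ₁
    have h1 : ContinuousAt (fun x : ℝ => (x ^ 2 + r ^ 2 - R ^ 2) / (2 * r * x)) ρ :=
      ContinuousAt.div (by fun_prop) (by fun_prop) (by positivity)
    exact (continuousAt_id.pow n).mul (Real.continuous_arccos.continuousAt.comp h1)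

theorem continuous_θ₁_fst (R r : ℝ) : Continuous fun ρ => θ₁ ρ R r := by
  unfold θ₁
  exact Real.continuous_arccos.comp (by fun_prop)

theorem continuous_k_fst (R r : ℝ) : Continuous fun ρ => k ρ R r := by
  unfold k
  fun_prop

theorem continuous_lensPrimitive (R : ℝ) {r : ℝ} (hr : r ≠ 0) :
    Continuous (lensPrimitive R r) := by
  have h1 := continuous_pow_mul_θ₁ R r two_ne_zero hr
  have h2 := continuous_θ₁_fst R r
  have h3 := continuous_k_fst R r
  have h : lensPrimitive R r =
      fun ρ => ρ ^ 2 * θ₁ R ρ r / 2 + R ^ 2 / 2 * θ₁ ρ R r - k ρ R r / 4 := by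
    ext ρ; rw [lensPrimitive]; ring
  rw [h]
  fun_prop

theorem continuous_cubicPrimitive (R : ℝ) {r : ℝ} (hr : r ≠ 0) :
    Continuous (cubicPrimitive R r) := by
  have h1 := continuous_pow_mul_θ₁ R r four_ne_zero hr
  have h2 := continuous_θ₁_fst R r
  have h3 := continuous_k_fst R r
  have h : cubicPrimitive R r =
      fun ρ => ρ ^ 4 * θ₁ R ρ r / 4 + R ^ 2 * (R ^ 2 + 2 * r ^ 2) / 4 * θ₁ ρ R r -
        (ρ ^ 2 + 5 * R ^ 2 + r ^ 2) * k ρ R r / 16 := by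
    ext ρ; rw [cubicPrimitive]; ring
  rw [h]
  fun_prop

theorem lensPrimitive_zero {R r : ℝ} (hR : 0 < R) (hr : 0 < r) : lensPrimitive R r 0 = 0 := by
  rw [lensPrimitive, θ₁_eq_zero hR hr (by nlinarith [sq_nonneg (r - R)]), k,
    Real.sqrt_eq_zero_of_nonpos (by nlinarith [sq_nonneg (r ^ 2 - R ^ 2)])]
  ring

theorem cubicPrimitive_zero {R r : ℝ} (hR : 0 < R) (hr : 0 < r) : cubicPrimitive R r 0 = 0 := by
  rw [cubicPrimitive, θ₁_eq_zero hR hr (by nlinarith [sq_nonneg (r - R)]), k,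
    Real.sqrt_eq_zero_of_nonpos (by nlinarith [sq_nonneg (r ^ 2 - R ^ 2)])]
  ring

theorem integral_mul_θ₁ {R r a : ℝ} (hr : 0 < r) (ha : 0 < a) (haR : a ≤ R) :
    ∫ ρ in 0..a, ρ * θ₁ R ρ r = lensPrimitive R r a := by
  have hc := continuous_pow_mul_θ₁ R r one_ne_zero hr.ne'
  simp only [pow_one] at hc
  rw [integral_eq_of_hasDerivAt_off_countable_of_le (lensPrimitive R r) _ ha.le
    (Set.countable_singleton |R - r|) (continuous_lensPrimitive R hr.ne').continuousOn
    (fun x hx => hasDerivAt_lensPrimitive hr hx.1.1 (hx.1.2.trans_le haR) hx.2)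
    (hc.intervalIntegrable _ _), lensPrimitive_zero (ha.trans_le haR) hr, sub_zero]

theorem integral_cube_mul_θ₁ {R r a : ℝ} (hr : 0 < r) (ha : 0 < a) (haR : a ≤ R) :
    ∫ ρ in 0..a, ρ ^ 3 * θ₁ R ρ r = cubicPrimitive R r a := by
  have hc := continuous_pow_mul_θ₁ R r three_ne_zero hr.ne'
  rw [integral_eq_of_hasDerivAt_off_countable_of_le (cubicPrimitive R r) _ ha.le
    (Set.countable_singleton |R - r|) (continuous_cubicPrimitive R hr.ne').continuousOn
    (fun x hx => hasDerivAt_cubicPrimitive hr hx.1.1 (hx.1.2.trans_le haR) hx.2)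
    (hc.intervalIntegrable _ _), cubicPrimitive_zero (ha.trans_le haR) hr, sub_zero]

/-! ### The radial density and the mean angle -/

/-- The density of the distance of node 1 from the center. -/
noncomputable def radialDensity (s : Scenario) (R₁ ρ : ℝ) : ℝ :=
  match s with
  | .s₁ => if 0 ≤ ρ ∧ ρ ≤ R₁ then 2 * ρ / R₁ ^ 2 else 0
  | .s₂ => rwpRadialDensity R₁ ρ

theorem radialDensity_eq_zero (s : Scenario) {R₁ ρ : ℝ} (h : ρ ∉ Set.Ioc 0 R₁) :
    radialDensity s R₁ ρ = 0 := by
  have h0 : (0 ≤ ρ ∧ ρ ≤ R₁) → ρ = 0 := fun h1 => by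
    by_contra h2
    exact h ⟨lt_of_le_of_ne h1.1 (Ne.symm h2), h1.2⟩
  cases s <;> simp only [radialDensity, rwpRadialDensity] <;> split_ifs with h1
  all_goals first | rfl | simp [h0 h1]

theorem radialDensity_nonneg (s : Scenario) (R₁ ρ : ℝ) : 0 ≤ radialDensity s R₁ ρ := by
  cases s <;> simp only [radialDensity, rwpRadialDensity] <;> split_ifs with h
  · have := h.1; positivity
  · rfl
  · have h0 := h.1
    have : ρ ^ 2 / R₁ ^ 2 ≤ 1 := div_le_one_of_le₀ (by gcongr; exact h.2) (by positivity)
    exact mul_nonneg (by positivity) (by linarith)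
  · rfl

theorem measurable_radialDensity (s : Scenario) (R₁ : ℝ) : Measurable (radialDensity s R₁) := by
  have hs : MeasurableSet {ρ : ℝ | 0 ≤ ρ ∧ ρ ≤ R₁} := measurableSet_Icc
  cases s
  · exact Measurable.ite hs (by fun_prop) measurable_const
  · exact Measurable.ite hs (by fun_prop) measurable_const

/-- Closed form of the mean of `θ₁ R ρ r` when `ρ` follows `radialDensity s R₁`. -/
noncomputable def meanAngle (s : Scenario) (R₁ R r : ℝ) : ℝ :=
  match s with
  | .s₁ => 2 / R₁ ^ 2 * lensPrimitive R r R₁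
  | .s₂ => 4 / R₁ ^ 2 * lensPrimitive R r R₁ - 4 / R₁ ^ 4 * cubicPrimitive R r R₁

theorem radialDensity_mul_θ₁ (s : Scenario) {R₁ R r : ℝ} (hR₁ : 0 < R₁) (hR : R₁ ≤ R)
    (hr : 0 < r) :
    IntervalIntegrable (fun ρ => radialDensity s R₁ ρ * θ₁ R ρ r) volume 0 R₁ ∧
      ∫ ρ in 0..R₁, radialDensity s R₁ ρ * θ₁ R ρ r = meanAngle s R₁ R r := by
  have hc1 := continuous_pow_mul_θ₁ R r one_ne_zero hr.ne'
  simp only [pow_one] at hc1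
  have hc3 := continuous_pow_mul_θ₁ R r three_ne_zero hr.ne'
  have hmem : ∀ ρ ∈ Set.uIcc 0 R₁, 0 ≤ ρ ∧ ρ ≤ R₁ := fun ρ hρ => by
    rwa [Set.uIcc_of_le hR₁.le] at hρ
  cases s
  · have h : Set.EqOn (fun ρ => 2 / R₁ ^ 2 * (ρ * θ₁ R ρ r))
        (fun ρ => radialDensity .s₁ R₁ ρ * θ₁ R ρ r) (Set.uIcc 0 R₁) := fun ρ hρ => by
      simp only [radialDensity, if_pos (hmem ρ hρ)]
      ring
    refine ⟨?_, ?_⟩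
    · exact ((hc1.const_mul _).intervalIntegrable 0 R₁).congr (h.mono Set.uIoc_subset_uIcc)
    · rw [← intervalIntegral.integral_congr h, intervalIntegral.integral_const_mul,
        integral_mul_θ₁ hr hR₁ hR, meanAngle]
  · have h : Set.EqOn (fun ρ => 4 / R₁ ^ 2 * (ρ * θ₁ R ρ r) - 4 / R₁ ^ 4 * (ρ ^ 3 * θ₁ R ρ r))
        (fun ρ => radialDensity .s₂ R₁ ρ * θ₁ R ρ r) (Set.uIcc 0 R₁) := fun ρ hρ => by
      simp only [radialDensity, rwpRadialDensity, if_pos (hmem ρ hρ)]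
      field_simp
    refine ⟨?_, ?_⟩
    · exact (((hc1.const_mul _).sub (hc3.const_mul _)).intervalIntegrable 0 R₁).congr
        (h.mono Set.uIoc_subset_uIcc)
    · rw [← intervalIntegral.integral_congr h, intervalIntegral.integral_sub
        ((hc1.const_mul _).intervalIntegrable _ _) ((hc3.const_mul _).intervalIntegrable _ _),
        intervalIntegral.integral_const_mul, intervalIntegral.integral_const_mul,
        integral_mul_θ₁ hr hR₁ hR, integral_cube_mul_θ₁ hr hR₁ hR, meanAngle]

theorem meanAngle_eq_zero (s : Scenario) {R₁ R r : ℝ} (hR₁ : 0 < R₁) (hR : R₁ ≤ R)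
    (hr : R₁ + R ≤ r) : meanAngle s R₁ R r = 0 := by
  have h1 : θ₁ R R₁ r = 0 := θ₁_eq_zero hR₁ (by linarith) (by gcongr <;> linarith)
  have h2 : θ₁ R₁ R r = 0 := θ₁_eq_zero (by linarith) (by linarith) (by gcongr; linarith)
  have h3 : k R₁ R r = 0 := k_eq_zero_of_add_le (by nlinarith) (by gcongr; linarith)
  cases s <;> simp [meanAngle, lensPrimitive, cubicPrimitive, h1, h2, h3]

theorem meanAngle_eq_pi (s : Scenario) {R₁ R r : ℝ} (hR₁ : 0 < R₁) (hr0 : 0 < r)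
    (hr : R₁ + r ≤ R) : meanAngle s R₁ R r = Real.pi := by
  have h1 : θ₁ R R₁ r = Real.pi := θ₁_eq_pi hR₁ (by linarith) (by gcongr; linarith)
  have h2 : θ₁ R₁ R r = 0 := θ₁_eq_zero (by linarith) (by linarith) (by nlinarith)
  have h3 : k R₁ R r = 0 := k_eq_zero_of_le_sub (by gcongr; linarith) (by gcongr; linarith)
  cases s
  · simp [meanAngle, lensPrimitive, h1, h2, h3]
    field_simp
  · simp [meanAngle, lensPrimitive, cubicPrimitive, h1, h2, h3]
    field_simp
    norm_num

theorem θ₂_eq_θ₁ (R ρ r : ℝ) : θ₂ R ρ r = θ₁ R ρ r := rfl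

theorem k_swap (R ρ r : ℝ) : k ρ R r = k R ρ r := by
  rw [k, k]
  ring_nf

/-- The piecewise closed form is the mean, over the radial density, of the angle under which the
annulus is seen. -/
theorem distanceDensity_eq (s : Scenario) {R₁ R₂ r : ℝ} (hR₁ : 0 < R₁) (hR₂ : 3 * R₁ < R₂)
    (hr : 0 < r) :
    distanceDensity s R₁ R₂ r =
      2 * r / S R₁ R₂ * (meanAngle s R₁ R₂ r - meanAngle s R₁ R₁ r) := by
  have hS : 0 < S R₁ R₂ := mul_pos Real.pi_pos (by nlinarith)
  have hD : 0 < R₂ ^ 2 - R₁ ^ 2 := by nlinarith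
  have hpi := Real.pi_pos
  unfold distanceDensity
  split_ifs with h1 h2 h3
  -- The outer circle contributes `π`, since `R₁ + r ≤ 3 * R₁ ≤ R₂`.
  · rw [meanAngle_eq_pi s hR₁ hr (by linarith)]
    have hk := k_eq_mul_sin (a := R₁) hR₁ hr
    cases s
    · simp only [meanAngle, lensPrimitive, hk, p₁, p₂, φ₀]
      field_simp
      ring
    · simp only [meanAngle, lensPrimitive, cubicPrimitive, hk, p₁, p₂, φ₀]
      field_simp
      ring
  · rw [meanAngle_eq_pi s hR₁ hr (by linarith), meanAngle_eq_zero s hR₁ le_rfl (by linarith), S]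
    field_simp
    ring
  · rw [meanAngle_eq_zero s (R := R₁) hR₁ le_rfl (by linarith)]
    cases s
    · have hk := k_eq_mul_sin (a := R₁) (b := R₂) (by linarith) hr
      simp only [meanAngle, lensPrimitive, k_swap R₂ R₁, hk, p₃, p₄, p₅, p₆, φ₁, φ₂, θ₂_eq_θ₁]
      field_simp
      ring
    · simp only [meanAngle, lensPrimitive, cubicPrimitive, p₃, p₄, p₅, p₆, φ₁, φ₂, θ₂_eq_θ₁]
      field_simp
      ring
  -- Beyond `R₁ + R₂` both mean angles vanish.
  · have : R₁ + R₂ < r := by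
      by_contra h4
      by_cases h5 : r ≤ 2 * R₁
      · exact h1 ⟨hr.le, h5⟩
      by_cases h6 : r ≤ R₂ - R₁
      · exact h2 ⟨by linarith, h6⟩
      exact h3 ⟨by linarith, by linarith⟩
    rw [meanAngle_eq_zero s hR₁ le_rfl (by linarith),
      meanAngle_eq_zero s hR₁ (by linarith) this.le]
    ring

theorem θ₁_mono {R R' ρ r : ℝ} (hR : 0 ≤ R) (h : R ≤ R') (hρ : 0 ≤ ρ) (hr : 0 ≤ r) :
    θ₁ R ρ r ≤ θ₁ R' ρ r := by
  apply Real.arccos_le_arccos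
  gcongr

theorem lintegral_radialDensity_mul (s : Scenario) {R₁ R₂ r : ℝ} (hR₁ : 0 < R₁)
    (hR₂ : 3 * R₁ < R₂) (hr : 0 < r) :
    ∫⁻ ρ, ENNReal.ofReal (radialDensity s R₁ ρ) *
      ENNReal.ofReal (2 * r / S R₁ R₂ * (θ₁ R₂ ρ r - θ₁ R₁ ρ r)) =
      ENNReal.ofReal (distanceDensity s R₁ R₂ r) := by
  have hS : 0 < S R₁ R₂ := mul_pos Real.pi_pos (by nlinarith)
  obtain ⟨i1, e1⟩ := radialDensity_mul_θ₁ s hR₁ le_rfl hr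
  obtain ⟨i2, e2⟩ := radialDensity_mul_θ₁ s hR₁ (by linarith : R₁ ≤ R₂) hr
  have hnn : ∀ ρ ∈ Set.Ioc 0 R₁, 0 ≤ 2 * r / S R₁ R₂ *
      (radialDensity s R₁ ρ * θ₁ R₂ ρ r - radialDensity s R₁ ρ * θ₁ R₁ ρ r) := fun ρ hρ => by
    rw [← mul_sub]
    exact mul_nonneg (by positivity) (mul_nonneg (radialDensity_nonneg ..)
      (sub_nonneg.2 (θ₁_mono hR₁.le (by linarith) hρ.1.le hr.le)))
  rw [distanceDensity_eq s hR₁ hR₂ hr, ← e1, ← e2, ← intervalIntegral.integral_sub i2 i1,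
    ← intervalIntegral.integral_const_mul, intervalIntegral.integral_of_le hR₁.le,
    ofReal_integral_eq_lintegral_ofReal ((i2.sub i1).const_mul _).1
      ((ae_restrict_iff' measurableSet_Ioc).2 (Filter.Eventually.of_forall hnn))]
  rw [← setLIntegral_eq_of_support_subset (s := Set.Ioc 0 R₁) (fun ρ hρ => by
    by_contra h
    exact hρ (by simp [radialDensity_eq_zero s h]))]
  refine setLIntegral_congr_fun measurableSet_Ioc fun ρ hρ => ?_
  rw [← ENNReal.ofReal_mul (radialDensity_nonneg ..)]
  ring_nf

theorem distanceDensity_of_nonpos (s : Scenario) {R₁ R₂ r : ℝ} (hR₁ : 0 < R₁)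
    (hR₂ : 3 * R₁ < R₂) (hr : r ≤ 0) : distanceDensity s R₁ R₂ r = 0 := by
  rcases hr.eq_or_lt with rfl | hr
  · rw [distanceDensity, if_pos ⟨le_rfl, by linarith⟩]
    simp
  · rw [distanceDensity, if_neg (by intro h; linarith [h.1]), if_neg (by intro h; linarith [h.1]),
      if_neg (by intro h; linarith [h.1])]

theorem distanceDensity_nonneg (s : Scenario) {R₁ R₂ : ℝ} (hR₁ : 0 < R₁)
    (hR₂ : 3 * R₁ < R₂) (r : ℝ) : 0 ≤ distanceDensity s R₁ R₂ r := by
  rcases lt_or_ge 0 r with hr | hr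
  · have hS : 0 < S R₁ R₂ := mul_pos Real.pi_pos (by nlinarith)
    rw [distanceDensity_eq s hR₁ hR₂ hr]
    obtain ⟨i1, e1⟩ := radialDensity_mul_θ₁ s hR₁ le_rfl hr
    obtain ⟨i2, e2⟩ := radialDensity_mul_θ₁ s hR₁ (by linarith : R₁ ≤ R₂) hr
    refine mul_nonneg (by positivity) (sub_nonneg.2 ?_)
    rw [← e1, ← e2]
    refine intervalIntegral.integral_mono_on hR₁.le i1 i2 fun ρ hρ => ?_
    exact mul_le_mul_of_nonneg_left (θ₁_mono hR₁.le (by linarith) hρ.1 hr.le)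
      (radialDensity_nonneg ..)
  · exact (distanceDensity_of_nonpos s hR₁ hR₂ hr).ge

/-! ### Polar coordinates around a point of the disk -/

theorem exists_linearIsometryEquiv_apply_eq_norm (x : Plane) :
    ∃ e : Plane ≃ₗᵢ[ℝ] ℂ, e x = (‖x‖ : ℂ) := by
  let e₀ : Plane ≃ₗᵢ[ℝ] ℂ := Complex.orthonormalBasisOneI.repr.symm
  refine ⟨e₀.trans (rotation (Circle.exp (-(e₀ x).arg))), ?_⟩
  rw [LinearIsometryEquiv.trans_apply, rotation_apply, Circle.coe_exp, ← e₀.norm_map x]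
  generalize e₀ x = z
  have hz := Complex.norm_mul_exp_arg_mul_I z
  set a := z.arg
  rw [← hz, mul_left_comm, ← Complex.exp_add, hz]
  simp

theorem norm_ofReal_sub_polarCoord_symm (ρ r θ : ℝ) :
    ‖(ρ : ℂ) - Complex.polarCoord.symm (r, θ)‖ =
      √(ρ ^ 2 + r ^ 2 - 2 * r * ρ * Real.cos θ) := by
  rw [Complex.norm_def, Complex.normSq_apply]
  congr 1
  simp [Complex.polarCoord_symm_apply, Complex.cos_ofReal_im, Complex.sin_ofReal_im,
    Complex.cos_ofReal_re, Complex.sin_ofReal_re]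
  linear_combination r ^ 2 * Real.sin_sq_add_cos_sq θ

/-- Polar coordinates centered at `x`, for integrands depending on the distances to `0` and `x`. -/
theorem lintegral_norm_dist {W : ℝ → ℝ → ENNReal} (hW : Measurable (Function.uncurry W))
    (x : Plane) :
    ∫⁻ y : Plane, W ‖y‖ (dist x y) = ∫⁻ r in Set.Ioi 0, ENNReal.ofReal r *
      ∫⁻ θ in Set.Ioo (-Real.pi) Real.pi,
        W (√(‖x‖ ^ 2 + r ^ 2 - 2 * r * ‖x‖ * Real.cos θ)) r := by
  obtain ⟨e, he⟩ := exists_linearIsometryEquiv_apply_eq_norm x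
  have hW' : Measurable fun p : ℝ × ℝ => W p.1 p.2 := hW
  have h1 : ∫⁻ y : Plane, W ‖y‖ (dist x y) =
      ∫⁻ z : ℂ, W ‖(‖x‖ : ℂ) - z‖ ‖z‖ := by
    have hm : Measurable fun z : ℂ => W ‖(‖x‖ : ℂ) - z‖ ‖z‖ :=
      hW'.comp (by fun_prop : Measurable fun z : ℂ => (‖(‖x‖ : ℂ) - z‖, ‖z‖))
    rw [← lintegral_sub_left_eq_self (fun y => W ‖y‖ (dist x y)) x,
      ← e.measurePreserving.lintegral_comp hm]
    refine lintegral_congr fun z => ?_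
    rw [← he, ← map_sub, e.norm_map, e.norm_map, dist_eq_norm, sub_sub_cancel]
  rw [h1, ← Complex.lintegral_comp_polarCoord_symm, polarCoord_target,
    Measure.volume_eq_prod, setLIntegral_prod]
  · refine setLIntegral_congr_fun measurableSet_Ioi fun r hr => ?_
    have hr0 : 0 < r := hr
    rw [← lintegral_const_mul]
    · refine lintegral_congr fun θ => ?_
      rw [norm_ofReal_sub_polarCoord_symm, Complex.norm_polarCoord_symm, abs_of_pos hr0,
        smul_eq_mul]
    · exact hW'.comp (by fun_prop : Measurable fun θ : ℝ =>
        (√(‖x‖ ^ 2 + r ^ 2 - 2 * r * ‖x‖ * Real.cos θ), r))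
  · have : (fun p : ℝ × ℝ => ENNReal.ofReal p.1 • W ‖(‖x‖ : ℂ) - Complex.polarCoord.symm p‖
        ‖Complex.polarCoord.symm p‖) = fun p => ENNReal.ofReal p.1 *
        W (√(‖x‖ ^ 2 + p.1 ^ 2 - 2 * p.1 * ‖x‖ * Real.cos p.2)) |p.1| := by
      ext p
      rw [norm_ofReal_sub_polarCoord_symm, Complex.norm_polarCoord_symm, smul_eq_mul]
    rw [this]
    exact (Measurable.mul (by fun_prop) (hW'.comp (by fun_prop : Measurable fun p : ℝ × ℝ =>
      (√(‖x‖ ^ 2 + p.1 ^ 2 - 2 * p.1 * ‖x‖ * Real.cos p.2), |p.1|)))).aemeasurable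

theorem lintegral_norm {h : ℝ → ENNReal} (hh : Measurable h) :
    ∫⁻ y : Plane, h ‖y‖ =
      ∫⁻ r in Set.Ioi 0, ENNReal.ofReal (2 * Real.pi * r) * h r := by
  have := lintegral_norm_dist (W := fun _ r => h r) (hh.comp measurable_snd) 0
  simp only [dist_zero_left, lintegral_const, Measure.restrict_apply_univ, Real.volume_Ioo] at this
  rw [this]
  refine setLIntegral_congr_fun measurableSet_Ioi fun r hr => ?_
  have hr0 : 0 < r := hr
  have hpi := Real.pi_pos
  rw [mul_comm (h r), ← mul_assoc, ← ENNReal.ofReal_mul hr0.le]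
  congr 2
  ring

/-- No bound on `c` is needed, thanks to the clamping of `arccos`. -/
theorem lt_cos_iff_abs_lt_arccos {c θ : ℝ} (hθ : |θ| < Real.pi) :
    c < Real.cos θ ↔ |θ| < Real.arccos c := by
  rw [← Real.cos_abs]
  rcases lt_or_ge 1 c with h1 | h1
  · rw [Real.arccos_of_one_le h1.le]
    exact iff_of_false (by linarith [Real.cos_le_one |θ|]) (abs_nonneg θ).not_gt
  rcases lt_or_ge c (-1) with h2 | h2
  · rw [Real.arccos_of_le_neg_one h2.le]
    exact iff_of_true (by linarith [Real.neg_one_le_cos |θ|]) hθ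
  conv_lhs => rw [← Real.cos_arccos h2 h1]
  exact Real.strictAntiOn_cos.lt_iff_gt ⟨Real.arccos_nonneg c, Real.arccos_le_pi c⟩
    ⟨abs_nonneg θ, hθ.le⟩

/-- Seen from a point at distance `ρ` from the center, the directions in which a step of length `r`
ends inside the open disk of radius `R` form an interval of half-length `θ₁ R ρ r`. -/
theorem sqrt_law_of_cosines_lt_iff {R ρ r θ : ℝ} (hR : 0 < R) (hρ : 0 < ρ) (hr : 0 < r)
    (hθ : |θ| < Real.pi) :
    √(ρ ^ 2 + r ^ 2 - 2 * r * ρ * Real.cos θ) < R ↔ |θ| < θ₁ R ρ r := by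
  rw [θ₁, ← lt_cos_iff_abs_lt_arccos hθ, Real.sqrt_lt' hR, div_lt_iff₀ (by positivity)]
  constructor <;> intro h <;> linarith

theorem volume_annulus_directions {R₁ R₂ ρ r : ℝ} (hR₁ : 0 < R₁) (hR : R₁ ≤ R₂) (hρ : 0 < ρ)
    (hr : 0 < r) :
    (volume.restrict (Set.Ioo (-Real.pi) Real.pi))
      {θ | √(ρ ^ 2 + r ^ 2 - 2 * r * ρ * Real.cos θ) ∈ Set.Ico R₁ R₂} =
      ENNReal.ofReal (2 * (θ₁ R₂ ρ r - θ₁ R₁ ρ r)) := by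
  have hm := θ₁_mono hR₁.le hR hρ.le hr.le
  have h0 : 0 ≤ θ₁ R₁ ρ r := Real.arccos_nonneg _
  have hpi : θ₁ R₂ ρ r ≤ Real.pi := Real.arccos_le_pi _
  rw [Measure.restrict_apply (by measurability)]
  have : {θ | √(ρ ^ 2 + r ^ 2 - 2 * r * ρ * Real.cos θ) ∈ Set.Ico R₁ R₂} ∩
      Set.Ioo (-Real.pi) Real.pi =
      Set.Ioo (-θ₁ R₂ ρ r) (θ₁ R₂ ρ r) \ Set.Ioo (-θ₁ R₁ ρ r) (θ₁ R₁ ρ r) := by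
    ext θ
    simp only [Set.mem_inter_iff, Set.mem_ofPred_eq, Set.mem_Ico, Set.mem_sdiff, Set.mem_Ioo,
      ← abs_lt]
    constructor
    · rintro ⟨⟨h1, h2⟩, h3⟩
      rw [sqrt_law_of_cosines_lt_iff (hR₁.trans_le hR) hρ hr h3] at h2
      rw [← not_lt, sqrt_law_of_cosines_lt_iff hR₁ hρ hr h3] at h1
      exact ⟨h2, h1⟩
    · rintro ⟨h1, h2⟩
      have h3 : |θ| < Real.pi := h1.trans_le hpi
      rw [sqrt_law_of_cosines_lt_iff (hR₁.trans_le hR) hρ hr h3, ← not_lt (b := R₁),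
        sqrt_law_of_cosines_lt_iff hR₁ hρ hr h3]
      exact ⟨⟨h2, h1⟩, h3⟩
  rw [this, measure_sdiff (Set.Ioo_subset_Ioo (by linarith) hm) measurableSet_Ioo.nullMeasurableSet
    (by simp), Real.volume_Ioo, Real.volume_Ioo, ← ENNReal.ofReal_sub _ (by linarith)]
  ring_nf

theorem annulus_eq (R₁ R₂ : ℝ) :
    annulus R₁ R₂ = Metric.closedBall 0 R₂ \ Metric.ball 0 R₁ := by
  ext x
  simp [annulus, and_comm]

theorem volume_annulus {R₁ R₂ : ℝ} (hR₁ : 0 ≤ R₁) (hR : R₁ ≤ R₂) :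
    volume (annulus R₁ R₂) = ENNReal.ofReal (S R₁ R₂) := by
  have hpi := Real.pi_pos.le
  have hfin : volume (Metric.ball (0 : Plane) R₁) ≠ ⊤ := measure_ball_lt_top.ne
  rw [annulus_eq, measure_sdiff (Metric.ball_subset_closedBall.trans
    (Metric.closedBall_subset_closedBall hR)) measurableSet_ball.nullMeasurableSet hfin,
    EuclideanSpace.volume_closedBall_fin_two, EuclideanSpace.volume_ball_fin_two, S,
    ← ENNReal.ofReal_pow hR₁, ← ENNReal.ofReal_pow (hR₁.trans hR),
    ← ENNReal.ofReal_mul (by positivity), ← ENNReal.ofReal_mul (by positivity),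
    ← ENNReal.ofReal_sub _ (by positivity)]
  ring_nf

/-- The law of the distance from a fixed point `x ≠ 0` to a uniform point of the annulus. -/
theorem cond_annulus_preimage_dist {R₁ R₂ : ℝ} (hR₁ : 0 < R₁) (hR : R₁ < R₂) {x : Plane}
    (hx : x ≠ 0) {A : Set ℝ} (hA : MeasurableSet A) :
    ProbabilityTheory.cond volume (annulus R₁ R₂) (dist x ⁻¹' A) =
      ∫⁻ r in Set.Ioi 0, A.indicator 1 r *
        ENNReal.ofReal (2 * r / S R₁ R₂ * (θ₁ R₂ ‖x‖ r - θ₁ R₁ ‖x‖ r)) := by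
  have hS : 0 < S R₁ R₂ := mul_pos Real.pi_pos (by nlinarith)
  have hρ : 0 < ‖x‖ := norm_pos_iff.2 hx
  have hmA : MeasurableSet (dist x ⁻¹' A) := (by fun_prop : Measurable (dist x)) hA
  -- Half-open in the radius: the outer boundary circle is a null set.
  let W : ℝ → ℝ → ENNReal := fun a r => (Set.Ico R₁ R₂).indicator 1 a * A.indicator 1 r
  have hi1 : Measurable ((Set.Ico R₁ R₂).indicator (1 : ℝ → ENNReal)) :=
    measurable_one.indicator measurableSet_Ico
  have hi2 : Measurable (A.indicator (1 : ℝ → ENNReal)) := measurable_one.indicator hA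
  have hW : Measurable (Function.uncurry W) :=
    (hi1.comp measurable_fst).mul (hi2.comp measurable_snd)
  have hmann : MeasurableSet (annulus R₁ R₂) := by
    rw [annulus_eq]; exact measurableSet_closedBall.diff measurableSet_ball
  have h1 : volume (annulus R₁ R₂ ∩ dist x ⁻¹' A) = ∫⁻ y : Plane, W ‖y‖ (dist x y) := by
    rw [← lintegral_indicator_one (hmann.inter hmA)]
    refine lintegral_congr_ae ?_
    have hsph : ∀ᵐ y : Plane, y ∉ Metric.sphere (0 : Plane) R₂ :=
      measure_eq_zero_iff_ae_notMem.1 (Measure.addHaar_sphere volume (0 : Plane) R₂)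
    filter_upwards [hsph] with y hy
    have hy' : ‖y‖ ≠ R₂ := by simpa using hy
    by_cases ha : dist x y ∈ A <;>
      simp [W, Set.indicator, annulus, ha, hy'.le_iff_lt]
  rw [ProbabilityTheory.cond_apply hmann, h1, lintegral_norm_dist hW, volume_annulus hR₁.le hR.le,
    ← lintegral_const_mul]
  · refine setLIntegral_congr_fun measurableSet_Ioi fun r hr => ?_
    have hr0 : 0 < r := hr
    simp only [W]
    have h2 : ∫⁻ θ in Set.Ioo (-Real.pi) Real.pi, (Set.Ico R₁ R₂).indicator (1 : ℝ → ENNReal)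
        (√(‖x‖ ^ 2 + r ^ 2 - 2 * r * ‖x‖ * Real.cos θ)) =
        ENNReal.ofReal (2 * (θ₁ R₂ ‖x‖ r - θ₁ R₁ ‖x‖ r)) := by
      rw [← volume_annulus_directions hR₁ hR.le hρ hr0,
        ← lintegral_indicator_one (by measurability)]
      rfl
    have h3 : Measurable fun θ : ℝ => (Set.Ico R₁ R₂).indicator (1 : ℝ → ENNReal)
        (√(‖x‖ ^ 2 + r ^ 2 - 2 * r * ‖x‖ * Real.cos θ)) := hi1.comp (by fun_prop)
    rw [lintegral_mul_const _ h3, h2, ← ENNReal.ofReal_inv_of_pos hS]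
    have hm := θ₁_mono hR₁.le hR.le hρ.le hr0.le
    rw [mul_comm _ (A.indicator 1 r), mul_left_comm _ (A.indicator 1 r),
      mul_left_comm _ (A.indicator 1 r),
      ← ENNReal.ofReal_mul hr0.le, ← ENNReal.ofReal_mul (by positivity)]
    congr 2
    field_simp
  · refine Measurable.mul (by fun_prop) (Measurable.lintegral_prod_right' (f := fun p : ℝ × ℝ =>
      W (√(‖x‖ ^ 2 + p.1 ^ 2 - 2 * p.1 * ‖x‖ * Real.cos p.2)) p.1) ?_)
    exact hW.comp (by fun_prop : Measurable fun p : ℝ × ℝ =>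
      (√(‖x‖ ^ 2 + p.1 ^ 2 - 2 * p.1 * ‖x‖ * Real.cos p.2), p.1))

/-! ### Laws of the distances -/

@[fun_prop]
theorem measurable_θ₁ {α : Type*} [MeasurableSpace α] (R : ℝ) {f g : α → ℝ} (hf : Measurable f)
    (hg : Measurable g) : Measurable fun a => θ₁ R (f a) (g a) :=
  Real.measurable_arccos.comp (by fun_prop)

variable {Ω : Type*} [MeasurableSpace Ω] {P : Measure Ω}

theorem map_norm_eq_withDensity [IsFiniteMeasure P] {s : Scenario} {R₁ : ℝ} (hR₁ : 0 < R₁)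
    {X : Ω → Plane} (hX : Measurable X) (hlaw : Node1Law s R₁ X P) :
    P.map (fun ω => ‖X ω‖) =
      volume.withDensity fun ρ => ENNReal.ofReal (radialDensity s R₁ ρ) := by
  cases s with
  | s₁ =>
    have hu : P.map X = ProbabilityTheory.cond volume (disk R₁) := hlaw
    have hd : disk R₁ = Metric.closedBall 0 R₁ := by ext; simp [disk]
    ext A hA
    rw [show (fun ω => ‖X ω‖) = norm ∘ X from rfl, ← Measure.map_map measurable_norm hX, hu,
      Measure.map_apply measurable_norm hA, ProbabilityTheory.cond_apply
        (hd ▸ measurableSet_closedBall), withDensity_apply _ hA]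
    have h1 : volume (disk R₁ ∩ norm ⁻¹' A) =
        ∫⁻ y : Plane, (Set.Iic R₁ ∩ A).indicator (1 : ℝ → ENNReal) ‖y‖ := by
      rw [← lintegral_indicator_one ((hd ▸ measurableSet_closedBall).inter (measurable_norm hA))]
      rfl
    rw [h1, lintegral_norm (measurable_one.indicator (measurableSet_Iic.inter hA)), hd,
      EuclideanSpace.volume_closedBall_fin_two, ← lintegral_indicator hA, ← lintegral_const_mul]
    · rw [setLIntegral_eq_of_support_subset]
      · refine lintegral_congr fun r => ?_
        have hpi := Real.pi_pos
        by_cases hrA : r ∈ A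
        · by_cases hr : 0 ≤ r ∧ r ≤ R₁
          · simp only [Set.indicator, Set.mem_inter_iff, Set.mem_Iic, hr.2, hrA, and_self, if_true,
              Pi.one_apply, mul_one, radialDensity, hr.1]
            rw [← ENNReal.ofReal_pow hR₁.le, ← ENNReal.ofReal_mul (by positivity),
              ← ENNReal.ofReal_inv_of_pos (by positivity), ← ENNReal.ofReal_mul (by positivity)]
            congr 1
            field_simp
          · rcases not_and_or.1 hr with h | h
            · have h' : 2 * Real.pi * r ≤ 0 :=
                mul_nonpos_of_nonneg_of_nonpos (by positivity) (not_le.1 h).le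
              simp [Set.indicator, radialDensity, h, ENNReal.ofReal_of_nonpos h']
            · simp [Set.indicator, radialDensity, h]
        · simp [hrA]
      · intro r hr
        by_contra h
        have h' : 2 * Real.pi * r ≤ 0 :=
          mul_nonpos_of_nonneg_of_nonpos (by positivity) (not_lt.1 h)
        exact hr (by simp [ENNReal.ofReal_of_nonpos h'])
    · have := (measurable_one (α := ENNReal)).indicator
        ((measurableSet_Iic (a := R₁)).inter hA)
      fun_prop
  | s₂ =>
    obtain ⟨-, h1, h2⟩ := hlaw
    rw [map_eq_withDensity_pdf (fun ω => ‖X ω‖) P volume]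
    exact withDensity_congr_ae h2

theorem map_dist_eq_withDensity [IsFiniteMeasure P] {s : Scenario} {R₁ R₂ : ℝ} (hR₁ : 0 < R₁)
    (hR₂ : 3 * R₁ < R₂) {X Y : Ω → Plane} (hX : Measurable X) (hY : Measurable Y)
    (hXY : IndepFun X Y P) (hlawX : Node1Law s R₁ X P)
    (hlawY : pdf.IsUniform Y (annulus R₁ R₂) P volume) :
    P.map (fun ω => dist (X ω) (Y ω)) =
      volume.withDensity fun r => ENNReal.ofReal (distanceDensity s R₁ R₂ r) := by
  have hnorm := map_norm_eq_withDensity hR₁ hX hlawX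
  have hprod := (indepFun_iff_map_prod_eq_prod_map_map hX.aemeasurable hY.aemeasurable).1 hXY
  ext A hA
  have hi : Measurable (A.indicator (1 : ℝ → ENNReal)) := measurable_one.indicator hA
  obtain ⟨F, hFdef⟩ : ∃ F : ℝ × ℝ → ENNReal, ∀ ρ r, F (ρ, r) = A.indicator 1 r *
      ENNReal.ofReal (2 * r / S R₁ R₂ * (θ₁ R₂ ρ r - θ₁ R₁ ρ r)) :=
    ⟨fun p => A.indicator 1 p.2 *
      ENNReal.ofReal (2 * p.2 / S R₁ R₂ * (θ₁ R₂ p.1 p.2 - θ₁ R₁ p.1 p.2)), fun _ _ => rfl⟩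
  have hF : Measurable F := by
    have h3 : Measurable fun p : ℝ × ℝ => A.indicator (1 : ℝ → ENNReal) p.2 *
      ENNReal.ofReal (2 * p.2 / S R₁ R₂ * (θ₁ R₂ p.1 p.2 - θ₁ R₁ p.1 p.2)) :=
      (hi.comp measurable_snd).mul (by fun_prop)
    rwa [show F = _ from funext fun p => hFdef p.1 p.2]
  -- The center has to be excluded, because `θ₁ R 0 r` is a junk value.
  have hne : ∀ᵐ x ∂P.map X, x ≠ 0 := by
    have h0 : ∀ᵐ ρ ∂P.map (fun ω => ‖X ω‖), ρ ≠ 0 := by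
      rw [hnorm]
      exact (withDensity_absolutelyContinuous _ _).ae_le (Measure.ae_ne volume (0 : ℝ))
    have h1 := ae_of_ae_map hX.norm.aemeasurable h0
    rw [ae_map_iff hX.aemeasurable (p := fun x => x ≠ 0) (measurableSet_singleton _).compl]
    simpa using h1
  calc P.map (fun ω => dist (X ω) (Y ω)) A
      = ((P.map X).prod (P.map Y)) ((fun p : Plane × Plane => dist p.1 p.2) ⁻¹' A) := by
        rw [← hprod, Measure.map_apply (hX.dist hY) hA,
          Measure.map_apply (hX.prodMk hY) ((by fun_prop : Measurable _) hA)]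
        rfl
    _ = ∫⁻ x, (P.map Y) (dist x ⁻¹' A) ∂P.map X := by
        rw [Measure.prod_apply ((by fun_prop : Measurable _) hA)]
        rfl
    _ = ∫⁻ x, (∫⁻ r in Set.Ioi 0, F (‖x‖, r)) ∂P.map X := by
        refine lintegral_congr_ae ?_
        filter_upwards [hne] with x hx
        rw [show P.map Y = _ from hlawY]
        simp only [hFdef]
        exact cond_annulus_preimage_dist hR₁ (by linarith) hx hA
    _ = ∫⁻ ρ, (∫⁻ r in Set.Ioi 0, F (ρ, r)) ∂P.map (fun ω => ‖X ω‖) := by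
        rw [show (fun ω => ‖X ω‖) = norm ∘ X from rfl, ← Measure.map_map measurable_norm hX,
          lintegral_map hF.lintegral_prod_right' measurable_norm]
    _ = ∫⁻ ρ, ∫⁻ r in Set.Ioi 0, ENNReal.ofReal (radialDensity s R₁ ρ) * F (ρ, r) := by
        rw [hnorm, lintegral_withDensity_eq_lintegral_mul _
          (measurable_radialDensity s R₁).ennreal_ofReal hF.lintegral_prod_right']
        refine lintegral_congr fun ρ => ?_
        have h1 : Measurable fun r => F (ρ, r) := hF.comp measurable_prodMk_left
        rw [Pi.mul_apply, lintegral_const_mul _ h1]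
    _ = ∫⁻ r in Set.Ioi 0, ∫⁻ ρ, ENNReal.ofReal (radialDensity s R₁ ρ) * F (ρ, r) :=
        lintegral_lintegral_swap (((measurable_radialDensity s R₁).ennreal_ofReal.comp
          measurable_fst).mul hF).aemeasurable
    _ = ∫⁻ r in Set.Ioi 0, A.indicator 1 r * ENNReal.ofReal (distanceDensity s R₁ R₂ r) := by
        refine setLIntegral_congr_fun measurableSet_Ioi fun r hr => ?_
        simp only [hFdef]
        have hmean := lintegral_radialDensity_mul s hR₁ hR₂ (Set.mem_Ioi.1 hr)
        rw [← hmean, ← lintegral_const_mul]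
        · refine lintegral_congr fun ρ => ?_
          rw [mul_left_comm]
        · have h3 := (measurable_radialDensity s R₁).ennreal_ofReal
          fun_prop
    _ = ∫⁻ r, A.indicator 1 r * ENNReal.ofReal (distanceDensity s R₁ R₂ r) := by
        refine setLIntegral_eq_of_support_subset fun r hr => ?_
        by_contra h
        exact hr (by simp [distanceDensity_of_nonpos s hR₁ hR₂ (not_lt.1 h)])
    _ = (volume.withDensity fun r => ENNReal.ofReal (distanceDensity s R₁ R₂ r)) A := by
        rw [withDensity_apply _ hA, ← lintegral_indicator hA]
        refine lintegral_congr fun r => ?_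
        by_cases h : r ∈ A <;> simp [h]

theorem measurable_distanceDensity (s : Scenario) (R₁ R₂ : ℝ) :
    Measurable (distanceDensity s R₁ R₂) := by
  have h0 : Measurable fun r => φ₀ R₁ r := by unfold φ₀; fun_prop
  have h1 : Measurable fun r => φ₁ R₁ R₂ r := by unfold φ₁; fun_prop
  have h2 : Measurable fun r => φ₂ R₁ R₂ r := by simp only [φ₂, θ₂_eq_θ₁]; fun_prop
  have hk : Measurable fun r => k R₁ R₂ r := by unfold k; fun_prop
  have m1 : MeasurableSet {r : ℝ | 0 ≤ r ∧ r ≤ 2 * R₁} := measurableSet_Icc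
  have m2 : MeasurableSet {r : ℝ | 2 * R₁ < r ∧ r ≤ R₂ - R₁} := measurableSet_Ioc
  have m3 : MeasurableSet {r : ℝ | R₂ - R₁ < r ∧ r ≤ R₁ + R₂} := measurableSet_Ioc
  unfold distanceDensity
  cases s <;> simp only [p₁, p₂, p₃, p₄, p₅, p₆] <;>
    exact Measurable.ite m1 (by fun_prop) (Measurable.ite m2 (by fun_prop)
      (Measurable.ite m3 (by fun_prop) measurable_const))

end DiskAnnulus

theorem theorem2 {Ω : Type*} [MeasurableSpace Ω] (P : Measure Ω) [IsProbabilityMeasure P]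
    (R₁ R₂ : ℝ) (hR₁ : 0 < R₁) (hR₂ : 3 * R₁ < R₂)
    (s : DiskAnnulus.Scenario) (X Y : Ω → DiskAnnulus.Plane)
    (hX : Measurable X) (hY : Measurable Y) (hXY : IndepFun X Y P)
    (hlawX : DiskAnnulus.Node1Law s R₁ X P)
    (hlawY : pdf.IsUniform Y (DiskAnnulus.annulus R₁ R₂) P volume) :
    DiskAnnulus.IsDensityOf (DiskAnnulus.distanceDensity s R₁ R₂)
      (fun ω => dist (X ω) (Y ω)) P := by
  have hmap := DiskAnnulus.map_dist_eq_withDensity hR₁ hR₂ hX hY hXY hlawX hlawY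
  have hf := (DiskAnnulus.measurable_distanceDensity s R₁ R₂).ennreal_ofReal.aemeasurable
    (μ := volume)
  have hpdf : HasPDF (fun ω => dist (X ω) (Y ω)) P volume :=
    hasPDF_of_map_eq_withDensity (hX.dist hY).aemeasurable _ hf hmap
  exact ⟨DiskAnnulus.distanceDensity_nonneg s hR₁ hR₂, hpdf,
    (pdf.eq_of_map_eq_withDensity _ hf).1 hmap⟩
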